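/- For $m \in \mathbb{N}_0$ let $H_m = 1 + \frac12 + \cdots + \frac1m$ denote the $m$-th harmonic number (with $H_0 = 0$). Then the series below converges (in the usual sense: its partial sums have a limit), and $$ -\frac{2 \ln 2}{\pi} = \sum_{i=0}^{\infty} \left(-\frac{1}{64}\right)^{i} \binom{2i}{i}^3 (4i+1)\, H_{2i}. $$ -/

import Mathlib

open Filter Topology

/-! Twice the series is the row n = 0 of F = `wzSummand`, which with G = `wzCompanion` satisfies
F(n,i) - F(n+1,i) = G(n,i+1) - G(n,i) (`wzSummand_sub`). Since G(n,0) = 0, summing over i < N and n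
< M trades row 0 for row M plus the boundary sum of G(n,N) over n < M (`sum_wzSummand_zero`). For
fixed N, as M → ∞ only i = 0 survives in row M; its limit -4 log 2 / π comes from Wallis' product
and H_{2M} - H_M → log 2. The boundary sum is O(N^{-1/2} log N) uniformly in M
(`abs_sum_wzCompanion_le`), so it vanishes as N → ∞. -/

/-! ### Harmonic numbers -/

/-- The harmonic numbers as reals. -/
noncomputable def realHarmonic (n : ℕ) : ℝ := (harmonic n : ℝ)

lemma realHarmonic_zero : realHarmonic 0 = 0 := by simp [realHarmonic]

lemma realHarmonic_succ (n : ℕ) : realHarmonic (n + 1) = realHarmonic n + 1 / ((n : ℝ) + 1) := by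
  simp [realHarmonic, harmonic_succ]

lemma realHarmonic_mono : Monotone realHarmonic := by
  refine monotone_nat_of_le_succ fun n => ?_
  rw [realHarmonic_succ]
  have : 0 ≤ 1 / ((n : ℝ) + 1) := by positivity
  linarith

lemma realHarmonic_nonneg (n : ℕ) : 0 ≤ realHarmonic n := by
  simpa [realHarmonic_zero] using realHarmonic_mono (Nat.zero_le n)

lemma realHarmonic_add_le (n i : ℕ) :
    realHarmonic (n + i) ≤ realHarmonic n + realHarmonic i := by
  induction i with
  | zero => simp [realHarmonic_zero]
  | succ i ih =>
    rw [← add_assoc, realHarmonic_succ, realHarmonic_succ]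
    have : 1 / (((n + i : ℕ) : ℝ) + 1) ≤ 1 / ((i : ℝ) + 1) := by
      apply one_div_le_one_div_of_le (by positivity)
      push_cast
      have : (0 : ℝ) ≤ n := by positivity
      linarith
    linarith

lemma realHarmonic_add_le_add_div (n i : ℕ) :
    realHarmonic (n + i) ≤ realHarmonic n + i / ((n : ℝ) + 1) := by
  induction i with
  | zero => simp
  | succ i ih =>
    rw [← add_assoc, realHarmonic_succ]
    have : 1 / (((n + i : ℕ) : ℝ) + 1) ≤ 1 / ((n : ℝ) + 1) := by
      apply one_div_le_one_div_of_le (by positivity)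
      push_cast
      have : (0 : ℝ) ≤ i := by positivity
      linarith
    rw [Nat.cast_succ i, add_div]
    linarith

lemma realHarmonic_two_mul_le (n : ℕ) : realHarmonic (2 * n) ≤ realHarmonic n + 1 := by
  have h := realHarmonic_add_le_add_div n n
  have : (n : ℝ) / ((n : ℝ) + 1) ≤ 1 := by
    rw [div_le_one (by positivity)]
    linarith
  rw [two_mul]
  linarith

lemma realHarmonic_two_mul_succ (n : ℕ) : realHarmonic (2 * (n + 1)) =
    realHarmonic (2 * n) + 1 / (2 * (n : ℝ) + 1) + 1 / (2 * (n : ℝ) + 2) := by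
  rw [show 2 * (n + 1) = 2 * n + 1 + 1 by ring, realHarmonic_succ, realHarmonic_succ]
  push_cast
  ring_nf

/-- The Euler–Mascheroni constants cancel, leaving log (2n) - log n. -/
lemma tendsto_realHarmonic_two_mul_sub :
    Tendsto (fun n => realHarmonic (2 * n) - realHarmonic n) atTop (𝓝 (Real.log 2)) := by
  have h2 : Tendsto (fun n : ℕ => 2 * n) atTop atTop :=
    tendsto_id.const_mul_atTop' two_pos
  have h := ((Real.tendsto_harmonic_sub_log.comp h2).sub Real.tendsto_harmonic_sub_log).add_const
    (Real.log 2)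
  rw [sub_self, zero_add] at h
  refine h.congr' ?_
  filter_upwards [eventually_gt_atTop 0] with n hn
  have hn' : (n : ℝ) ≠ 0 := by positivity
  simp only [Function.comp, Nat.cast_mul, Nat.cast_ofNat, realHarmonic]
  rw [Real.log_mul two_ne_zero hn']
  ring

/-! ### Central binomial coefficients and Wallis' product -/

/-- The normalized central binomial coefficient `binom (2n) n / 4 ^ n`. -/
noncomputable def normCentralBinom (n : ℕ) : ℝ := (n.centralBinom : ℝ) / 4 ^ n

lemma normCentralBinom_zero : normCentralBinom 0 = 1 := by simp [normCentralBinom]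

lemma normCentralBinom_succ (n : ℕ) :
    normCentralBinom (n + 1) = normCentralBinom n * ((2 * n + 1) / (2 * n + 2)) := by
  have h : ((n : ℝ) + 1) * ((n + 1).centralBinom : ℝ) = 2 * (2 * n + 1) * n.centralBinom := by
    exact_mod_cast Nat.succ_mul_centralBinom_succ n
  have h1 : (n : ℝ) + 1 ≠ 0 := by positivity
  unfold normCentralBinom
  rw [pow_succ, div_mul_div_comm, div_eq_div_iff (by positivity) (by positivity)]
  linear_combination (4 ^ n * 2 : ℝ) * h

lemma normCentralBinom_pos (n : ℕ) : 0 < normCentralBinom n :=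
  div_pos (Nat.cast_pos.2 n.centralBinom_pos) (by positivity)

lemma normCentralBinom_antitone : Antitone normCentralBinom := by
  refine antitone_nat_of_succ_le fun n => ?_
  rw [normCentralBinom_succ]
  apply mul_le_of_le_one_right (normCentralBinom_pos n).le
  rw [div_le_one (by positivity)]
  linarith

lemma normCentralBinom_le_one (n : ℕ) : normCentralBinom n ≤ 1 := by
  simpa [normCentralBinom_zero] using normCentralBinom_antitone (Nat.zero_le n)

lemma normCentralBinom_sq_mul (n : ℕ) :
    normCentralBinom n ^ 2 * (2 * n + 1) = (Real.Wallis.W n)⁻¹ := by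
  induction n with
  | zero => simp [normCentralBinom_zero, Real.Wallis.W]
  | succ n ih =>
    rw [Real.Wallis.W_succ, mul_inv, ← ih, normCentralBinom_succ]
    push_cast
    have h1 : (2 * n + 1 : ℝ) ≠ 0 := by positivity
    have h2 : (2 * n + 2 : ℝ) ≠ 0 := by positivity
    have h3 : (2 * n + 3 : ℝ) ≠ 0 := by positivity
    field_simp
    ring

lemma normCentralBinom_sq_mul_le_one (n : ℕ) : normCentralBinom n ^ 2 * (2 * n + 1) ≤ 1 := by
  induction n with
  | zero => simp [normCentralBinom_zero]
  | succ n ih =>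
    refine le_trans ?_ ih
    rw [normCentralBinom_succ, mul_pow, mul_assoc]
    apply mul_le_mul_of_nonneg_left _ (sq_nonneg _)
    have h0 : (0 : ℝ) ≤ n := by positivity
    push_cast
    rw [div_pow, div_mul_eq_mul_div, div_le_iff₀ (by positivity)]
    nlinarith

lemma tendsto_normCentralBinom_sq_mul :
    Tendsto (fun n : ℕ => normCentralBinom n ^ 2 * (2 * n + 1)) atTop (𝓝 (2 / Real.pi)) := by
  simp_rw [normCentralBinom_sq_mul]
  rw [← inv_div]
  exact Real.Wallis.tendsto_W_nhds_pi_div_two.inv₀ (by positivity)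

/-! ### Reciprocal binomial coefficients -/

/-- The reciprocal of the binomial coefficient `binom (n + i) i`. -/
noncomputable def invChoose (n i : ℕ) : ℝ :=
  (i.factorial : ℝ) * n.factorial / (n + i).factorial

lemma invChoose_nonneg (n i : ℕ) : 0 ≤ invChoose n i := by unfold invChoose; positivity

lemma invChoose_zero_right (n : ℕ) : invChoose n 0 = 1 := by
  have : (n.factorial : ℝ) ≠ 0 := by positivity
  simp [invChoose, this]

lemma invChoose_zero_left (i : ℕ) : invChoose 0 i = 1 := by
  have : (i.factorial : ℝ) ≠ 0 := by positivity
  simp [invChoose, this]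

lemma invChoose_succ_right (n i : ℕ) :
    invChoose n (i + 1) = invChoose n i * ((i + 1) / (n + i + 1)) := by
  unfold invChoose
  rw [← add_assoc, Nat.factorial_succ, Nat.factorial_succ]
  push_cast
  rw [div_mul_div_comm]
  congr 1 <;> ring

lemma invChoose_succ_left (n i : ℕ) :
    invChoose (n + 1) i = invChoose n i * ((n + 1) / (n + i + 1)) := by
  unfold invChoose
  rw [show n + 1 + i = n + i + 1 by ring, Nat.factorial_succ, Nat.factorial_succ]
  push_cast
  rw [div_mul_div_comm]
  congr 1 <;> ring

lemma invChoose_antitone (n : ℕ) : Antitone (invChoose n) := by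
  refine antitone_nat_of_succ_le fun i => ?_
  rw [invChoose_succ_right]
  apply mul_le_of_le_one_right (invChoose_nonneg n i)
  rw [div_le_one (by positivity)]
  have : (0 : ℝ) ≤ n := by positivity
  linarith

lemma invChoose_le_of_one_le {i : ℕ} (n : ℕ) (hi : 1 ≤ i) : invChoose n i ≤ 1 / (n + 1) := by
  refine (invChoose_antitone n hi).trans_eq ?_
  have := invChoose_succ_right n 0
  simpa [invChoose_zero_right] using this

lemma invChoose_le_of_two_le {i : ℕ} (n : ℕ) (hi : 2 ≤ i) :
    invChoose n i ≤ 2 / (n + 1) - 2 / (n + 2) := by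
  refine (invChoose_antitone n hi).trans_eq ?_
  rw [invChoose_succ_right n 1, invChoose_succ_right n 0, invChoose_zero_right]
  have h1 : (n : ℝ) + 1 ≠ 0 := by positivity
  have h2 : (n : ℝ) + 2 ≠ 0 := by positivity
  have h3 : (n : ℝ) + 1 + 1 ≠ 0 := by positivity
  push_cast
  field_simp
  ring

/-- The bound for i = 2 telescopes; for i = 1 the sum would be harmonic and diverge. -/
lemma sum_invChoose_le {i : ℕ} (hi : 2 ≤ i) (M : ℕ) :
    ∑ n ∈ Finset.range M, invChoose n i ≤ 2 := by
  have h : ∑ n ∈ Finset.range M, invChoose n i ≤ 2 - 2 / ((M : ℝ) + 1) := by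
    induction M with
    | zero => simp
    | succ M ih =>
      rw [Finset.sum_range_succ]
      have := invChoose_le_of_two_le M hi
      push_cast
      rw [show (M : ℝ) + 1 + 1 = M + 2 by ring]
      linarith
  have : 0 ≤ 2 / ((M : ℝ) + 1) := by positivity
  linarith

/-! ### The Wilf–Zeilberger pair -/

/-- The common hypergeometric factor of the Wilf–Zeilberger pair. -/
noncomputable def wzWeight (n i : ℕ) : ℝ :=
  (-1) ^ i * (normCentralBinom (n + i) * normCentralBinom i ^ 2 * normCentralBinom n *
    invChoose n i)

/-- The logarithmic derivative of the parametric version of `wzWeight` in the parameter. -/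
noncomputable def wzLogDeriv (n i : ℕ) : ℝ :=
  2 * realHarmonic (2 * i) - realHarmonic i - 2 * realHarmonic (2 * n) + realHarmonic n +
    realHarmonic (n + i)

/-- The summand of the differentiated Wilf–Zeilberger pair. -/
noncomputable def wzSummand (n i : ℕ) : ℝ :=
  wzWeight n i * (2 * n + 4 * i + 1) * wzLogDeriv n i

/-- The companion of `wzSummand`. -/
noncomputable def wzCompanion (n i : ℕ) : ℝ := -2 * i * wzWeight n i * wzLogDeriv n i

lemma wzWeight_succ_left (n i : ℕ) : wzWeight (n + 1) i =
    wzWeight n i * ((2 * n + 2 * i + 1) * (2 * n + 1) / (4 * (n + i + 1) ^ 2)) := by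
  unfold wzWeight
  rw [show n + 1 + i = n + i + 1 by ring, normCentralBinom_succ, normCentralBinom_succ,
    invChoose_succ_left]
  have h1 : (n : ℝ) + 1 ≠ 0 := by positivity
  have h2 : (n : ℝ) + i + 1 ≠ 0 := by positivity
  push_cast
  rw [show (2 * (n : ℝ) + 2) = 2 * (n + 1) by ring,
    show (2 * ((n : ℝ) + i) + 2) = 2 * (n + i + 1) by ring]
  field_simp
  ring

lemma wzWeight_succ_right (n i : ℕ) : wzWeight n (i + 1) =
    -wzWeight n i * ((2 * n + 2 * i + 1) * (2 * i + 1) ^ 2 /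
      (8 * (n + i + 1) ^ 2 * (i + 1))) := by
  unfold wzWeight
  rw [← add_assoc, normCentralBinom_succ, normCentralBinom_succ, invChoose_succ_right]
  have h1 : (i : ℝ) + 1 ≠ 0 := by positivity
  have h2 : (n : ℝ) + i + 1 ≠ 0 := by positivity
  push_cast
  rw [show (2 * (i : ℝ) + 2) = 2 * (i + 1) by ring,
    show (2 * ((n : ℝ) + i) + 2) = 2 * (n + i + 1) by ring]
  field_simp
  ring

lemma wzLogDeriv_succ_left (n i : ℕ) : wzLogDeriv (n + 1) i =
    wzLogDeriv n i - 2 / (2 * n + 1) + 1 / (n + i + 1) := by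
  unfold wzLogDeriv
  rw [show n + 1 + i = n + i + 1 by ring, realHarmonic_two_mul_succ, realHarmonic_succ,
    realHarmonic_succ]
  have h1 : (n : ℝ) + 1 ≠ 0 := by positivity
  rw [show (2 * (n : ℝ) + 2) = 2 * (n + 1) by ring]
  push_cast
  field_simp
  ring

lemma wzLogDeriv_succ_right (n i : ℕ) : wzLogDeriv n (i + 1) =
    wzLogDeriv n i + 2 / (2 * i + 1) + 1 / (n + i + 1) := by
  unfold wzLogDeriv
  rw [← add_assoc, realHarmonic_two_mul_succ, realHarmonic_succ, realHarmonic_succ]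
  have h1 : (i : ℝ) + 1 ≠ 0 := by positivity
  rw [show (2 * (i : ℝ) + 2) = 2 * (i + 1) by ring]
  push_cast
  field_simp
  ring

/-- Shifts multiply the weight by, and add to the logarithmic derivative, rational functions of n
and i, so only a rational identity remains. -/
lemma wzSummand_sub (n i : ℕ) :
    wzSummand n i - wzSummand (n + 1) i = wzCompanion n (i + 1) - wzCompanion n i := by
  unfold wzSummand wzCompanion
  rw [wzWeight_succ_left, wzWeight_succ_right, wzLogDeriv_succ_left, wzLogDeriv_succ_right]
  have h1 : (i : ℝ) + 1 ≠ 0 := by positivity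
  have h2 : (n : ℝ) + i + 1 ≠ 0 := by positivity
  have h3 : 2 * (n : ℝ) + 1 ≠ 0 := by positivity
  have h4 : 2 * (i : ℝ) + 1 ≠ 0 := by positivity
  push_cast
  field_simp
  ring

lemma sum_wzSummand_zero (N M : ℕ) : ∑ i ∈ Finset.range N, wzSummand 0 i =
    ∑ i ∈ Finset.range N, wzSummand M i + ∑ n ∈ Finset.range M, wzCompanion n N := by
  induction M with
  | zero => simp
  | succ M ih =>
    have h : ∑ i ∈ Finset.range N, (wzSummand M i - wzSummand (M + 1) i) = wzCompanion M N := by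
      simp_rw [wzSummand_sub]
      rw [Finset.sum_range_sub (wzCompanion M)]
      simp [wzCompanion]
    rw [Finset.sum_sub_distrib] at h
    rw [ih, Finset.sum_range_succ]
    linarith

/-! ### Uniform bounds on the boundary sum -/

/-- Uniform in n: H_n + H_{n+i} - 2 H_{2n} lies between -2 and H_i. -/
lemma abs_wzLogDeriv_le (n i : ℕ) : |wzLogDeriv n i| ≤ 2 * realHarmonic (2 * i) + 2 := by
  unfold wzLogDeriv
  have h1 := realHarmonic_mono (show i ≤ 2 * i by omega)
  have h2 := realHarmonic_mono (show n ≤ 2 * n by omega)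
  have h3 := realHarmonic_mono (show n ≤ n + i by omega)
  have h4 := realHarmonic_add_le n i
  have h5 := realHarmonic_two_mul_le n
  have h6 := realHarmonic_nonneg (2 * i)
  rw [abs_le]
  constructor <;> linarith

lemma abs_wzWeight_eq (n i : ℕ) : |wzWeight n i| =
    normCentralBinom (n + i) * normCentralBinom i ^ 2 * normCentralBinom n * invChoose n i := by
  unfold wzWeight
  rw [abs_mul, abs_pow, abs_neg, abs_one, one_pow, one_mul, abs_of_nonneg]
  have := normCentralBinom_pos (n + i)
  have := normCentralBinom_pos i
  have := normCentralBinom_pos n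
  have := invChoose_nonneg n i
  positivity

lemma abs_wzWeight_le (n i : ℕ) : |wzWeight n i| ≤ normCentralBinom i ^ 3 * invChoose n i := by
  rw [abs_wzWeight_eq]
  apply mul_le_mul_of_nonneg_right _ (invChoose_nonneg n i)
  have h0 := normCentralBinom_pos n
  have h1 := normCentralBinom_pos i
  have h2 := normCentralBinom_antitone (show i ≤ n + i by omega)
  calc normCentralBinom (n + i) * normCentralBinom i ^ 2 * normCentralBinom n
      ≤ normCentralBinom i * normCentralBinom i ^ 2 * 1 := by
        gcongr
        exact normCentralBinom_le_one n
    _ = _ := by ring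

lemma abs_sum_wzCompanion_le {N : ℕ} (hN : 2 ≤ N) (M : ℕ) :
    |∑ n ∈ Finset.range M, wzCompanion n N| ≤
      4 * normCentralBinom N * (realHarmonic (2 * N) + 1) := by
  have hp := normCentralBinom_pos N
  have hH := realHarmonic_nonneg (2 * N)
  have hterm : ∀ n, |wzCompanion n N| ≤
      (2 * N * normCentralBinom N ^ 3 * (2 * realHarmonic (2 * N) + 2)) * invChoose n N := by
    intro n
    unfold wzCompanion
    rw [abs_mul, abs_mul, abs_mul, abs_neg, abs_two, Nat.abs_cast]
    calc 2 * (N : ℝ) * |wzWeight n N| * |wzLogDeriv n N|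
        ≤ 2 * (N : ℝ) * (normCentralBinom N ^ 3 * invChoose n N) *
          (2 * realHarmonic (2 * N) + 2) := by
          have := invChoose_nonneg n N
          gcongr
          · exact abs_wzWeight_le n N
          · exact abs_wzLogDeriv_le n N
      _ = _ := by ring
  calc |∑ n ∈ Finset.range M, wzCompanion n N|
      ≤ ∑ n ∈ Finset.range M, |wzCompanion n N| := Finset.abs_sum_le_sum_abs _ _
    _ ≤ (2 * N * normCentralBinom N ^ 3 * (2 * realHarmonic (2 * N) + 2)) *
          ∑ n ∈ Finset.range M, invChoose n N := by
        rw [Finset.mul_sum]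
        exact Finset.sum_le_sum fun n _ => hterm n
    _ ≤ (2 * N * normCentralBinom N ^ 3 * (2 * realHarmonic (2 * N) + 2)) * 2 := by
        gcongr
        exact sum_invChoose_le hN M
    -- Two of the three binomial factors absorb 2N; the third, of order N^{-1/2}, is kept to beat
    -- the logarithm.
    _ = (normCentralBinom N ^ 2 * (2 * N)) *
          (4 * normCentralBinom N * (realHarmonic (2 * N) + 1)) := by ring
    _ ≤ 1 * (4 * normCentralBinom N * (realHarmonic (2 * N) + 1)) := by
        gcongr
        have := normCentralBinom_sq_mul_le_one N
        nlinarith [sq_nonneg (normCentralBinom N)]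
    _ = _ := one_mul _

lemma normCentralBinom_le_inv_sqrt {n : ℕ} (hn : 0 < n) :
    normCentralBinom n ≤ 1 / √((2 * n : ℕ) : ℝ) := by
  have hn' : (0 : ℝ) < ((2 * n : ℕ) : ℝ) := by positivity
  rw [le_div_iff₀ (Real.sqrt_pos.2 hn')]
  have hp := normCentralBinom_pos n
  apply le_of_sq_le_sq _ zero_le_one
  rw [mul_pow, Real.sq_sqrt hn'.le]
  have := normCentralBinom_sq_mul_le_one n
  push_cast
  nlinarith [sq_nonneg (normCentralBinom n)]

lemma tendsto_normCentralBinom_mul_realHarmonic :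
    Tendsto (fun N => 4 * normCentralBinom N * (realHarmonic (2 * N) + 1)) atTop (𝓝 0) := by
  have h2 : Tendsto (fun n : ℕ => ((2 * n : ℕ) : ℝ)) atTop atTop :=
    tendsto_natCast_atTop_atTop.comp (tendsto_id.const_mul_atTop' two_pos)
  have hsqrt : Tendsto (fun x : ℝ => 8 * (√x)⁻¹) atTop (𝓝 0) := by
    simpa using (tendsto_inv_atTop_zero.comp Real.tendsto_sqrt_atTop).const_mul 8
  have hlog : Tendsto (fun x : ℝ => 4 * (Real.log x / √x)) atTop (𝓝 0) := by
    have h := (isLittleO_log_rpow_atTop (half_pos one_pos)).tendsto_div_nhds_zero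
    simpa [Real.sqrt_eq_rpow] using h.const_mul 4
  have hb := (hsqrt.add hlog).comp h2
  rw [add_zero] at hb
  refine squeeze_zero' (Eventually.of_forall fun N => ?_) ?_ hb
  · have := normCentralBinom_pos N
    have := realHarmonic_nonneg (2 * N)
    positivity
  · filter_upwards [eventually_gt_atTop 0] with N hN
    have h1 : realHarmonic (2 * N) ≤ 1 + Real.log ((2 * N : ℕ) : ℝ) :=
      harmonic_le_one_add_log (2 * N)
    have h3 := normCentralBinom_le_inv_sqrt hN
    have h4 := realHarmonic_nonneg (2 * N)
    calc 4 * normCentralBinom N * (realHarmonic (2 * N) + 1)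
        ≤ 4 * (1 / √((2 * N : ℕ) : ℝ)) * (1 + Real.log ((2 * N : ℕ) : ℝ) + 1) := by gcongr
      _ = _ := by simp only [Function.comp]; ring

/-! ### Limit of row M -/

lemma tendsto_wzSummand_zero_right : Tendsto (fun n => wzSummand n 0) atTop
    (𝓝 (2 * (-(2 * Real.log 2) / Real.pi))) := by
  have h := tendsto_normCentralBinom_sq_mul.mul (tendsto_realHarmonic_two_mul_sub.const_mul (-2))
  rw [show 2 / Real.pi * (-2 * Real.log 2) = 2 * (-(2 * Real.log 2) / Real.pi) by ring] at h
  refine h.congr fun n => ?_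
  simp only [wzSummand, wzWeight, wzLogDeriv, normCentralBinom_zero, invChoose_zero_right,
    realHarmonic_zero, pow_zero, mul_zero, add_zero, Nat.cast_zero]
  ring

lemma tendsto_wzSummand_succ_right (i : ℕ) :
    Tendsto (fun n => wzSummand n (i + 1)) atTop (𝓝 0) := by
  set C : ℝ := (4 * (i + 1 : ℕ) + 1) * (2 * realHarmonic (2 * (i + 1)) + 2)
  have hlim : Tendsto (fun n : ℕ => C * (1 / ((n : ℝ) + 1))) atTop (𝓝 0) := by
    simpa using tendsto_one_div_add_atTop_nhds_zero_nat.const_mul C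
  refine squeeze_zero_norm (fun n => ?_) hlim
  have hH := realHarmonic_nonneg (2 * (i + 1))
  have hp := normCentralBinom_pos n
  have hp1 := normCentralBinom_pos (i + 1)
  have hw : |wzWeight n (i + 1)| ≤ normCentralBinom n ^ 2 * (1 / (n + 1)) := by
    rw [abs_wzWeight_eq]
    have hc := invChoose_nonneg n (i + 1)
    calc _ ≤ normCentralBinom n * 1 ^ 2 * normCentralBinom n * (1 / ((n : ℝ) + 1)) := by
          gcongr
          · exact normCentralBinom_antitone (by omega)
          · exact normCentralBinom_le_one _
          · exact invChoose_le_of_one_le n (by omega)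
      _ = _ := by ring
  -- Splitting off 2n + 1 lets the squared binomial factor absorb it, so the decay 1/(n+1) of
  -- `invChoose` survives.
  have hlin : 2 * (n : ℝ) + 4 * (i + 1 : ℕ) + 1 ≤ (2 * n + 1) * (4 * (i + 1 : ℕ) + 1) := by
    have : (0 : ℝ) ≤ n * (i + 1 : ℕ) := by positivity
    nlinarith
  rw [Real.norm_eq_abs, wzSummand, abs_mul, abs_mul,
    abs_of_nonneg (show (0 : ℝ) ≤ 2 * n + 4 * (i + 1 : ℕ) + 1 by positivity)]
  calc |wzWeight n (i + 1)| * (2 * n + 4 * (i + 1 : ℕ) + 1) * |wzLogDeriv n (i + 1)|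
      ≤ normCentralBinom n ^ 2 * (1 / (n + 1)) * ((2 * n + 1) * (4 * (i + 1 : ℕ) + 1)) *
          (2 * realHarmonic (2 * (i + 1)) + 2) := by
        gcongr
        exact abs_wzLogDeriv_le _ _
    _ = normCentralBinom n ^ 2 * (2 * n + 1) * (C * (1 / (n + 1))) := by simp only [C]; ring
    _ ≤ 1 * (C * (1 / (n + 1))) := by
        gcongr
        exact normCentralBinom_sq_mul_le_one n
    _ = _ := one_mul _

lemma tendsto_sum_wzSummand {N : ℕ} (hN : 0 < N) :
    Tendsto (fun M => ∑ i ∈ Finset.range N, wzSummand M i) atTop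
      (𝓝 (2 * (-(2 * Real.log 2) / Real.pi))) := by
  obtain ⟨k, rfl⟩ := Nat.exists_eq_succ_of_ne_zero hN.ne'
  simp_rw [Nat.succ_eq_add_one, Finset.sum_range_succ']
  simpa using (tendsto_finsetSum (Finset.range k)
    fun i _ => tendsto_wzSummand_succ_right i).add tendsto_wzSummand_zero_right

lemma wzSummand_zero_left (i : ℕ) : wzSummand 0 i =
    2 * ((-1 / 64 : ℝ) ^ i * ((Nat.choose (2 * i) i : ℕ) : ℝ) ^ 3 * (4 * (i : ℝ) + 1) *
      ((harmonic (2 * i) : ℚ) : ℝ)) := by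
  simp only [wzSummand, wzWeight, wzLogDeriv, normCentralBinom_zero, invChoose_zero_left,
    realHarmonic_zero, mul_zero, zero_add, Nat.cast_zero, mul_one]
  rw [normCentralBinom, Nat.centralBinom_eq_two_mul_choose, realHarmonic, div_pow (-1 : ℝ),
    show (64 : ℝ) = 4 ^ 3 by norm_num, ← pow_mul, mul_comm 3 i, pow_mul]
  field_simp
  ring

theorem theorem5 :
    Tendsto
      (fun N : ℕ => ∑ i ∈ Finset.range N,
        (-1 / 64 : ℝ) ^ i * ((Nat.choose (2 * i) i : ℕ) : ℝ) ^ 3 * (4 * (i : ℝ) + 1) *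
          ((harmonic (2 * i) : ℚ) : ℝ))
      atTop (𝓝 (-(2 * Real.log 2) / Real.pi)) := by
  have key : Tendsto (fun N : ℕ => ∑ i ∈ Finset.range N, wzSummand 0 i) atTop
      (𝓝 (2 * (-(2 * Real.log 2) / Real.pi))) := by
    rw [tendsto_iff_norm_sub_tendsto_zero]
    refine squeeze_zero' (Eventually.of_forall fun _ => norm_nonneg _) ?_
      tendsto_normCentralBinom_mul_realHarmonic
    filter_upwards [eventually_ge_atTop 2] with N hN
    -- With N fixed, the limit M → ∞ carries the M-independent boundary bound over to the distance
    -- from the limit.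
    refine le_of_tendsto ((tendsto_sum_wzSummand (by omega : 0 < N)).const_sub _).norm
      (Eventually.of_forall fun M => ?_)
    rw [sum_wzSummand_zero N M, add_sub_cancel_left]
    exact abs_sum_wzCompanion_le hN M
  simp_rw [wzSummand_zero_left, ← Finset.mul_sum] at key
  have h := key.const_mul (2⁻¹ : ℝ)
  rw [inv_mul_cancel_left₀ two_ne_zero] at h
  exact h.congr fun N => inv_mul_cancel_left₀ two_ne_zero _
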